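/- Let $C$ be a finite cell complex (a finite CW complex; in particular $C$ may be a finite simplicial or cubical complex), let $T$ be a totally ordered set with least element $0$ (for example $T=\{0,1,\dots,N\}$ or $T=\mathbb{R}_{\ge 0}$), and let $\mathbb{X}=(X_t)_{t\in T}$ be a filtration of $C$ by subcomplexes: $X_s\subseteq X_t$ for $s\le t$, and $X_0=\emptyset$. Suppose that every complex of the filtration has a first time at which it appears, i.e. for each $t$ the set $\{s\in T : X_s=X_t\}$ has a least element (this is automatic for $T=\{0,\dots,N\}$). Let $q\ge 0$. For a field $\Bbbk$, the $q$-th persistent homology $H_q(\mathbb{X};\Bbbk)$ consists of the singular homology spaces $H_q(X_t;\Bbbk)$ and the maps $H_q(X_s;\Bbbk)\to H_q(X_t;\Bbbk)$, $s\le t$, induced by the inclusions. For $b\in T$ and $d\in T\cup\{\infty\}$ let $I(b,d)$ be the persistence module that is $\Bbbk$ at the times $s$ with $b\le s<d$ and $0$ at all other times, with structure maps the identity from $s$ to $t$ if $b\le s\le t<d$ and $0$ otherwise. The persistence diagram $D_q(\mathbb{X};\Bbbk)$ is the multiset of pairs $(b_i,d_i)$, $0<b_i<d_i\le\infty$, such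 that $H_q(\mathbb{X};\Bbbk)\cong\bigoplus_i I(b_i,d_i)$ as persistence modules. Assume that 1. $H_q(X_n,X_m;\mathbb{Z})$ is free for all $m<n$ in $T$, and 2. $H_{q-1}(X_n;\mathbb{Z})$ is free for all $n\in T$ (where $H_{-1}=0$). Then $D_q(\mathbb{X};\Bbbk)$ is independent of the field $\Bbbk$, in particular it is the same for $\Bbbk=\mathbb{C}$, $\mathbb{R}$, $\mathbb{Q}$ and $\mathbb{Z}_p$ with $p$ any prime. That is, there is one family $(b_i,d_i)_{i\in I}$ such that for every field $\Bbbk$ this family is a persistence diagram of $H_q(\mathbb{X};\Bbbk)$, and every family of pairs that is a persistence diagram of $H_q(\mathbb{X};\Bbbk)$ for some field $\Bbbk$ agrees with it up to a bijection of the index sets. -/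

import Mathlib

universe u v w

open CategoryTheory
open scoped DirectSum

namespace PersistentHomology

noncomputable section

/-- The coefficient module `R`, seen in the universe of the spaces. -/
abbrev coeff (R : Type) [CommRing R] : ModuleCat.{u} R :=
  ModuleCat.of R (ULift.{u} R)

/-- The singular chain complex functor `X ↦ C_•(X; R)`. -/
abbrev chains (R : Type) [CommRing R] : TopCat.{u} ⥤ ChainComplex (ModuleCat.{u} R) ℕ :=
  (AlgebraicTopology.singularChainComplexFunctor (ModuleCat.{u} R)).obj (coeff R)

/-- The singular homology functor `X ↦ H_q(X; R)`. -/
abbrev homology (R : Type) [CommRing R] (q : ℕ) : TopCat.{u} ⥤ ModuleCat.{u} R :=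
  (AlgebraicTopology.singularHomologyFunctor (ModuleCat.{u} R) q).obj (coeff R)

/-- The inclusion map of a subspace `A` of a topological space into a larger subspace `B`. -/
def inclusion {E : Type u} [TopologicalSpace E] {A B : Set E} (h : A ⊆ B) :
    TopCat.of A ⟶ TopCat.of B :=
  TopCat.ofHom ⟨Set.inclusion h, continuous_inclusion h⟩

/-- The relative singular homology `H_q(B, A; R)` of a pair of subspaces `A ⊆ B`: the homology of
the quotient complex `C_•(B; R) / C_•(A; R)`. -/
def relativeHomology (R : Type) [CommRing R] (q : ℕ) {E : Type u} [TopologicalSpace E]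
    {A B : Set E} (h : A ⊆ B) : ModuleCat.{u} R :=
  (Limits.cokernel ((chains R).map (inclusion h))).homology q

/-- An increasing family of subspaces, as a functor to topological spaces whose maps are the
inclusions. -/
def filtration {T : Type v} [Preorder T] {E : Type u} [TopologicalSpace E] (X : T → Set E)
    (hX : Monotone X) : T ⥤ TopCat.{u} where
  obj t := TopCat.of (X t)
  map f := inclusion (hX (leOfHom f))

/-- The `q`-th persistent homology of a filtration: the modules `H_q(X_t; R)` with the maps
`H_q(X_s; R) ⟶ H_q(X_t; R)`, `s ≤ t`, induced by the inclusions. -/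
def persistentHomology (R : Type) [CommRing R] (q : ℕ) {T : Type v} [Preorder T] {E : Type u}
    [TopologicalSpace E] (X : T → Set E) (hX : Monotone X) : T ⥤ ModuleCat.{u} R :=
  filtration X hX ⋙ homology R q

open scoped Classical in
/-- The space at time `s` of the interval module `I(b, d)`: it is `K` if `b ≤ s < d`, and `0`
otherwise. -/
def intervalSpace (K : Type) [Field K] {T : Type v} [Preorder T] (b : T) (d : WithTop T) (s : T) :
    Submodule K K :=
  if b ≤ s ∧ (s : WithTop T) < d then ⊤ else ⊥

theorem intervalSpace_eq_top (K : Type) [Field K] {T : Type v} [Preorder T] {b : T}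
    {d : WithTop T} {s : T} (h : b ≤ s ∧ (s : WithTop T) < d) : intervalSpace K b d s = ⊤ :=
  if_pos h

open scoped Classical in
/-- The structure map from time `s` to time `t` of the interval module `I(b, d)`: it is the
identity of `K` if `b ≤ s ≤ t < d`, and `0` otherwise. -/
def intervalMap (K : Type) [Field K] {T : Type v} [Preorder T] (b : T) (d : WithTop T) (s t : T) :
    intervalSpace K b d s →ₗ[K] intervalSpace K b d t :=
  if h : b ≤ s ∧ s ≤ t ∧ (t : WithTop T) < d then
    Submodule.inclusion
      (le_top.trans (intervalSpace_eq_top K ⟨h.1.trans h.2.1, h.2.2⟩).ge)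
  else 0

/-- The family of pairs `(b i, d i)` is the persistence diagram of the persistence module `V`
over the field `K`: every pair satisfies `0 < b i < d i ≤ ∞`, and `V` is isomorphic, as a
persistence module, to the direct sum of the interval modules `I(b i, d i)`. -/
def IsPersistenceDiagram {K : Type} [Field K] {T : Type v} [PartialOrder T] [OrderBot T]
    (V : T ⥤ ModuleCat.{u} K) {ι : Type w} (b : ι → T) (d : ι → WithTop T) : Prop :=
  (∀ i, ⊥ < b i ∧ (b i : WithTop T) < d i) ∧
    ∃ e : ∀ s : T, V.obj s ≃ₗ[K] ⨁ i, intervalSpace K (b i) (d i) s,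
      ∀ (s t : T) (h : s ≤ t) (x : V.obj s) (i : ι),
        e t (V.map (homOfLE h) x) i = intervalMap K (b i) (d i) s t (e s x i)

end

end PersistentHomology

/-!
The persistence diagram is computed over `ℤ` and then carried to every field by extension of
scalars.

*Over `ℤ`.* By the exact sequence of the pair, the cokernel of `H_q(X_m) ⟶ H_q(X_n)` embeds into
`H_q(X_n, X_m)`, which is free; submodules of free `ℤ`-modules are free (`free_submodule`), so all
these cokernels are free, and so are the modules `H_q(X_n)` (the case `X_m = ∅`). A finite complex
has finitely many subcomplexes, so only finitely many times matter, namely the first appearances of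
the members of the filtration. Over a PID, a persistence module with finitely many times, free
modules and free cokernels is a direct sum of interval modules (`exists_intervalBasis`): the classes
born at `β` and dying at `δ` form the subquotient `K_δ / (K_δ ∩ (K_{<δ} + I_{<β}))` of `V_β`, where
`K_δ` is the kernel of `V_β ⟶ V_δ`, `K_{<δ}` the union of the earlier kernels and `I_{<β}` the image
of the earlier times. This subquotient embeds into a cokernel, hence it is free, and lifts of its
bases for all `β` and `δ` give compatible bases of all `V_s`. No finite generation is used.

*Change of coefficients.* The singular chains with coefficients in `K` are `K ⊗ C_•(X; ℤ)`. If
`H_{q-1}(X; ℤ)` is free, the differential `d` out of degree `q` has a pseudo-inverse, `d g d = d`,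
so that every additive functor preserves its kernel (`preservesKernel_of_pseudoinverse`); extension
of scalars also preserves cokernels, which gives `H_q(X; K) ≅ K ⊗ H_q(X; ℤ)`, naturally in the space
among those with `H_{q-1}` free (`homologyIso`, `homologyIso_naturality`). So the integral interval
basis becomes one over `K` with the same intervals.

*Uniqueness.* Over any nontrivial commutative ring the same subquotient, formed for an arbitrary
persistence module with an interval basis, has a basis indexed by the intervals equal to `[β, δ)`
(`IntervalBasis.ker_barCoord`), so the intervals are determined with their multiplicities
(`IntervalBasis.exists_equiv`).
-/

universe w'

namespace PersistentHomology

noncomputable section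

/-! ### Interval bases and persistence diagrams -/

/-- The interval `[b i, d i)` contains the time `s`. -/
def Alive {T : Type v} [Preorder T] {ι : Type w} (b : ι → T) (d : ι → WithTop T) (s : T) (i : ι) :
    Prop :=
  b i ≤ s ∧ (s : WithTop T) < d i

open scoped Classical in
/-- A decomposition of a persistence module over a commutative ring into the interval modules
`I(b i, d i)`, given by bases: the basis of `V_s` is indexed by the intervals that contain `s`, and
a structure map sends a basis element to the one with the same index, or to `0` if its interval has
ended. -/
structure IntervalBasis {R : Type} [CommRing R] {T : Type v} [Preorder T]
    (V : T ⥤ ModuleCat.{u} R) {ι : Type w} (b : ι → T) (d : ι → WithTop T) where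
  basis (s : T) : Module.Basis {i // Alive b d s i} R (V.obj s)
  map_basis (s t : T) (h : s ≤ t) (i : {i // Alive b d s i}) :
    V.map (homOfLE h) (basis s i) =
      if ht : Alive b d t i then basis t ⟨i, ht⟩ else 0

theorem dfinsupp_basis_apply {ι R : Type*} [DecidableEq ι] [Semiring R] {M : ι → Type*}
    [∀ i, AddCommMonoid (M i)] [∀ i, Module R (M i)] {φ : ι → Type*}
    (b : ∀ i, Module.Basis (φ i) R (M i)) (x : Σ i, φ i) :
    DFinsupp.basis b x = DFinsupp.single x.1 (b x.1 x.2) := by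
  classical
  rw [Module.Basis.apply_eq_iff]
  ext ⟨i, k⟩
  obtain ⟨j, l⟩ := x
  change (b i).repr (DFinsupp.single j (b j l) i) k = _
  by_cases h : j = i
  · subst h
    simp [Finsupp.single_apply]
  · simp [h]

section diagram

variable {K : Type} [Field K] {T : Type v} [PartialOrder T]
  {ι : Type w} (b : ι → T) (d : ι → WithTop T)

theorem intervalSpace_eq_bot {b : T} {d : WithTop T} {s : T}
    (h : ¬ (b ≤ s ∧ (s : WithTop T) < d)) : intervalSpace K b d s = ⊥ :=
  if_neg h

variable (K) in
/-- The basis of `I(b, d)` at time `s`: the element `1` if `s` lies in `[b, d)`, and the empty basis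
otherwise. -/
def intervalSpaceBasis (b : T) (d : WithTop T) (s : T) :
    Module.Basis (PLift (b ≤ s ∧ (s : WithTop T) < d)) K (intervalSpace K b d s) := by
  classical
  exact if h : b ≤ s ∧ (s : WithTop T) < d then
    haveI : Unique (PLift (b ≤ s ∧ (s : WithTop T) < d)) := ⟨⟨⟨h⟩⟩, fun _ => rfl⟩
    (Module.Basis.singleton _ K).map
      ((LinearEquiv.ofTop _ (intervalSpace_eq_top K h)).symm)
  else
    haveI : IsEmpty (PLift (b ≤ s ∧ (s : WithTop T) < d)) := ⟨fun x => h x.down⟩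
    haveI : Subsingleton (intervalSpace K b d s) := by
      rw [intervalSpace_eq_bot h]; infer_instance
    Module.Basis.empty _

theorem coe_intervalSpaceBasis (b : T) (d : WithTop T) (s : T) (i) :
    (intervalSpaceBasis K b d s i : K) = 1 := by
  unfold intervalSpaceBasis
  rw [dif_pos i.down]
  simp

open scoped Classical in
variable (K) in
/-- The basis of `⨁ i, I(b i, d i)` at time `s`, indexed by the intervals that contain `s`. -/
def sumBasis (s : T) : Module.Basis {i // Alive b d s i} K (⨁ i, intervalSpace K (b i) (d i) s) :=
  (DFinsupp.basis fun i => intervalSpaceBasis K (b i) (d i) s).reindex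
    ⟨fun x => ⟨x.1, x.2.down⟩, fun x => ⟨x.1, ⟨x.2⟩⟩, fun _ => rfl, fun _ => rfl⟩

open scoped Classical in
theorem sumBasis_apply (s : T) (i : {i // Alive b d s i}) (j : ι) :
    (sumBasis K b d s i j : K) = if (i : ι) = j then 1 else 0 := by
  obtain ⟨i, hi⟩ := i
  have : sumBasis K b d s ⟨i, hi⟩ =
      DFinsupp.single i (intervalSpaceBasis K (b i) (d i) s ⟨hi⟩) :=
    (Module.Basis.reindex_apply _ _ _).trans <|
      dfinsupp_basis_apply (fun i => intervalSpaceBasis K (b i) (d i) s) ⟨i, ⟨hi⟩⟩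
  rw [this]
  by_cases h : i = j
  · subst h
    have := coe_intervalSpaceBasis (K := K) (b i) (d i) s ⟨hi⟩
    simpa [DFinsupp.single_apply] using this
  · simp [DFinsupp.single_apply, h]

theorem coe_intervalMap_of_alive (b : T) (d : WithTop T) {s t : T}
    (h : b ≤ s ∧ s ≤ t ∧ (t : WithTop T) < d) (x : intervalSpace K b d s) :
    (intervalMap K b d s t x : K) = x := by
  unfold intervalMap
  rw [dif_pos h]
  rfl

open scoped Classical in
theorem coe_intervalMap_sumBasis {s t : T} (h : s ≤ t) (i : {i // Alive b d s i}) (j : ι) :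
    (intervalMap K (b j) (d j) s t (sumBasis K b d s i j) : K) =
      if Alive b d t i ∧ (i : ι) = j then 1 else 0 := by
  by_cases hij : (i : ι) = j
  · subst hij
    by_cases ht : Alive b d t i
    · rw [coe_intervalMap_of_alive _ _ ⟨i.2.1, h, ht.2⟩, sumBasis_apply]
      simp [ht]
    · have : intervalSpace K (b i) (d i) t = ⊥ := intervalSpace_eq_bot ht
      have h0 := (intervalMap K (b i) (d i) s t (sumBasis K b d s i i)).2
      simpa [ht] using (Submodule.mem_bot K).1 (this.le h0)
  · have : sumBasis K b d s i j = 0 := by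
      apply Subtype.ext
      rw [sumBasis_apply, if_neg hij]; rfl
    simp [this, hij]

variable [OrderBot T] {b d} {V : T ⥤ ModuleCat.{u} K}

open scoped Classical in
theorem IntervalBasis.isPersistenceDiagram (B : IntervalBasis V b d)
    (h : ∀ i, ⊥ < b i ∧ (b i : WithTop T) < d i) : IsPersistenceDiagram V b d := by
  refine ⟨h, fun s => (B.basis s).equiv (sumBasis K b d s) (Equiv.refl _), ?_⟩
  intro s t hst x j
  suffices H : (DFinsupp.lapply (R := K) j ∘ₗ ((B.basis t).equiv (sumBasis K b d t)
      (Equiv.refl _)).toLinearMap ∘ₗ (V.map (homOfLE hst)).hom :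
        _ →ₗ[K] intervalSpace K (b j) (d j) t) =
      intervalMap K (b j) (d j) s t ∘ₗ DFinsupp.lapply (R := K) j ∘ₗ
        ((B.basis s).equiv (sumBasis K b d s) (Equiv.refl _)).toLinearMap from
    LinearMap.congr_fun H x
  refine (B.basis s).ext fun i => Subtype.ext ?_
  simp only [LinearMap.comp_apply, LinearEquiv.coe_coe, Module.Basis.equiv_apply,
    Equiv.refl_apply]
  erw [B.map_basis s t hst i]
  erw [coe_intervalMap_sumBasis b d hst i j]
  by_cases ht : Alive b d t i
  · rw [dif_pos ht, Module.Basis.equiv_apply]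
    erw [sumBasis_apply]
    simp only [ht, true_and, Equiv.refl_apply]
    congr
  · rw [dif_neg ht]
    simp [ht]

open scoped Classical in
theorem IsPersistenceDiagram.nonempty_intervalBasis (h : IsPersistenceDiagram V b d) :
    Nonempty (IntervalBasis V b d) := by
  obtain ⟨-, e, he⟩ := h
  refine ⟨⟨fun s => (sumBasis K b d s).map (e s).symm, fun s t hst i => ?_⟩⟩
  apply (e t).injective
  refine DFinsupp.ext fun j => ?_
  rw [he s t hst]
  apply Subtype.ext
  simp only [Module.Basis.map_apply, LinearEquiv.apply_symm_apply]
  rw [coe_intervalMap_sumBasis b d hst]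
  by_cases ht : Alive b d t i
  · rw [dif_pos ht, LinearEquiv.apply_symm_apply, sumBasis_apply]
    simp [ht]
  · rw [dif_neg ht]
    simp [ht]

end diagram

/-! ### Uniqueness of the intervals -/

section submodules

variable {R : Type} [CommRing R] {T : Type v} [Preorder T] (V : T ⥤ ModuleCat.{u} R)

/-- The elements of `V_s` that vanish at every time `t ≥ s` with `t ≥ δ`. This is the kernel of
`V_s ⟶ V_δ` if `s ≤ δ < ∞`, all of `V_s` if `δ = ∞`, and `0` if `δ ≤ s`. -/
def kerTo (s : T) (δ : WithTop T) : Submodule R (V.obj s) :=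
  ⨅ (t : T) (h : s ≤ t) (_ : δ ≤ t), LinearMap.ker (V.map (homOfLE h)).hom

/-- The elements of `V_s` that are sums of elements which vanish from some time before `δ` on. -/
def kerBefore (s : T) (δ : WithTop T) : Submodule R (V.obj s) :=
  ⨆ (δ' : WithTop T) (_ : δ' < δ), kerTo V s δ'

/-- The elements of `V_s` that are sums of elements coming from times before `s`. -/
def imBefore (s : T) : Submodule R (V.obj s) :=
  ⨆ (r : T) (h : r < s), LinearMap.range (V.map (homOfLE h.le)).hom

variable {V}

theorem mem_kerTo {s : T} {δ : WithTop T} {x : V.obj s} :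
    x ∈ kerTo V s δ ↔ ∀ (t : T) (h : s ≤ t), δ ≤ t → V.map (homOfLE h) x = 0 := by
  simp [kerTo, Submodule.mem_iInf]

theorem kerTo_mono (s : T) : Monotone (kerTo V s) := fun _ _ h _ hx =>
  mem_kerTo.2 fun t ht hδ => mem_kerTo.1 hx t ht (h.trans hδ)

theorem kerTo_le_kerBefore (s : T) {δ δ' : WithTop T} (h : δ' < δ) :
    kerTo V s δ' ≤ kerBefore V s δ :=
  le_iSup₂_of_le δ' h le_rfl

theorem map_mem_imBefore {r s : T} (h : r < s) (x : V.obj r) :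
    V.map (homOfLE h.le) x ∈ imBefore V s :=
  (le_iSup₂_of_le (f := fun (r : T) (h : r < s) => LinearMap.range (V.map (homOfLE h.le)).hom)
    r h le_rfl) ⟨x, rfl⟩

theorem map_map_apply {r s t : T} (h : r ≤ s) (h' : s ≤ t) (x : V.obj r) :
    V.map (homOfLE h') (V.map (homOfLE h) x) = V.map (homOfLE (h.trans h')) x := by
  rw [← ModuleCat.comp_apply, ← V.map_comp, homOfLE_comp]

theorem map_refl_apply {s : T} (h : s ≤ s) (x : V.obj s) :
    V.map (homOfLE h) x = x := by
  have : homOfLE h = 𝟙 s := rfl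
  rw [this, V.map_id]; rfl

end submodules

namespace IntervalBasis

variable {R : Type} [CommRing R] {T : Type v} [LinearOrder T] {V : T ⥤ ModuleCat.{u} R}
  {ι : Type w} {b : ι → T} {d : ι → WithTop T} (B : IntervalBasis V b d)

include B

theorem repr_map {s t : T} (h : s ≤ t) (x : V.obj s) (i : ι) (hs : Alive b d s i)
    (ht : Alive b d t i) :
    (B.basis t).repr (V.map (homOfLE h) x) ⟨i, ht⟩ = (B.basis s).repr x ⟨i, hs⟩ := by
  suffices H : (B.basis t).coord ⟨i, ht⟩ ∘ₗ (V.map (homOfLE h)).hom = (B.basis s).coord ⟨i, hs⟩ from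
    LinearMap.congr_fun H x
  refine (B.basis s).ext fun j => ?_
  rw [LinearMap.comp_apply]
  erw [B.map_basis s t h j]
  classical
  by_cases hj : Alive b d t j
  · rw [dif_pos hj]
    simp [Finsupp.single_apply, Subtype.ext_iff]
  · rw [dif_neg hj]
    have : j ≠ ⟨i, hs⟩ := by rintro rfl; exact hj ht
    simp [this]

theorem repr_map_of_lt {r s : T} (h : r < s) (x : V.obj r) (i : {i // Alive b d s i})
    (hi : b i = s) : (B.basis s).repr (V.map (homOfLE h.le) x) i = 0 := by
  suffices H : (B.basis s).coord i ∘ₗ (V.map (homOfLE h.le)).hom = 0 from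
    LinearMap.congr_fun H x
  refine (B.basis r).ext fun j => ?_
  rw [LinearMap.comp_apply]
  erw [B.map_basis r s h.le j]
  classical
  by_cases hj : Alive b d s j
  · rw [dif_pos hj]
    have : (⟨j, hj⟩ : {i // Alive b d s i}) ≠ i := by
      rintro rfl
      exact (h.trans_le hi.ge).not_ge j.2.1
    simp [this]
  · rw [dif_neg hj]
    simp

/-- An element of `V_s` dies by `δ` exactly if all intervals occurring in it end by `δ`. -/
theorem mem_kerTo_iff {s : T} {δ : WithTop T} {x : V.obj s} :
    x ∈ kerTo V s δ ↔ ∀ i : {i // Alive b d s i}, (B.basis s).repr x i ≠ 0 → d i ≤ δ := by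
  constructor
  · intro hx i hi
    by_contra! hlt
    obtain ⟨t, rfl⟩ := WithTop.ne_top_iff_exists.1 hlt.ne_top
    have ht : Alive b d (max s t) i :=
      ⟨i.2.1.trans (le_max_left _ _), by
        rcases max_choice s t with h | h <;> rw [h]
        exacts [i.2.2, hlt]⟩
    apply hi
    rw [← B.repr_map (le_max_left s t) x i i.2 ht,
      mem_kerTo.1 hx _ (le_max_left s t) (WithTop.coe_le_coe.2 (le_max_right s t))]
    simp
  · intro hx
    rw [← (B.basis s).linearCombination_repr x, Finsupp.linearCombination_apply]
    refine Submodule.sum_mem _ fun i hi => Submodule.smul_mem _ _ (mem_kerTo.2 fun t h hδ => ?_)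
    rw [B.map_basis, dif_neg]
    exact fun hA => ((hx i (Finsupp.mem_support_iff.1 hi)).trans hδ).not_gt hA.2

theorem basis_mem_imBefore {s : T} (i : {i // Alive b d s i}) (hi : b i < s) :
    B.basis s i ∈ imBefore V s := by
  have hb : Alive b d (b i) i := ⟨le_rfl, (WithTop.coe_lt_coe.2 hi).trans i.2.2⟩
  have := B.map_basis (b i) s hi.le ⟨i, hb⟩
  rw [dif_pos i.2] at this
  rw [← show _ = B.basis s i from this]
  exact map_mem_imBefore hi _

/-- The coordinates at the intervals equal to `[β, δ)` of the elements of `V_β` that die by `δ`. -/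
def barCoord (β : T) (δ : WithTop T) (h : (β : WithTop T) < δ) :
    kerTo V β δ →ₗ[R] ({i // b i = β ∧ d i = δ} →₀ R) :=
  Finsupp.lcomapDomain (fun i => (⟨i, i.2.1.le, h.trans_eq i.2.2.symm⟩ : {i // Alive b d β i}))
    (fun _ _ hij => Subtype.ext (congrArg (fun k : {i // Alive b d β i} => (k : ι)) hij)) ∘ₗ
    (B.basis β).repr.toLinearMap ∘ₗ (kerTo V β δ).subtype

omit B in
theorem barCoord_apply (B : IntervalBasis V b d) (β : T) (δ : WithTop T)
    (h : (β : WithTop T) < δ) (x : kerTo V β δ) (i) :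
    B.barCoord β δ h x i = (B.basis β).repr x ⟨i, i.2.1.le, h.trans_eq i.2.2.symm⟩ := rfl

theorem barCoord_surjective (β : T) (δ : WithTop T) (h : (β : WithTop T) < δ) :
    Function.Surjective (B.barCoord β δ h) := by
  rw [← LinearMap.range_eq_top, ← top_le_iff, ← (Finsupp.basisSingleOne (R := R)).span_eq,
    Submodule.span_le]
  rintro - ⟨i, rfl⟩
  have hi : Alive b d β i := ⟨i.2.1.le, h.trans_eq i.2.2.symm⟩
  refine ⟨⟨B.basis β ⟨i, hi⟩, B.mem_kerTo_iff.2 fun j hj => ?_⟩, ?_⟩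
  · classical
    have : (⟨i, hi⟩ : {i // Alive b d β i}) = j := by
      by_contra hne
      exact hj (by simp [hne])
    rw [← this]
    exact i.2.2.le
  · classical
    ext j
    rw [barCoord_apply]
    simp [Finsupp.single_apply, Subtype.ext_iff]

/-- The kernel of `barCoord` does not depend on the interval basis. So the number of intervals equal
to `[β, δ)` is the rank of a subquotient of `V_β` that is defined by `V` alone. -/
theorem ker_barCoord (β : T) (δ : WithTop T) (h : (β : WithTop T) < δ) :
    LinearMap.ker (B.barCoord β δ h) =
      (kerBefore V β δ ⊔ imBefore V β).comap (kerTo V β δ).subtype := by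
  classical
  ext ⟨x, hx⟩
  rw [LinearMap.mem_ker, Submodule.mem_comap, Submodule.subtype_apply]
  constructor
  · intro h0
    change x ∈ _
    rw [← (B.basis β).linearCombination_repr x, Finsupp.linearCombination_apply]
    refine Submodule.sum_mem _ fun i hi => Submodule.smul_mem _ _ ?_
    rw [Finsupp.mem_support_iff] at hi
    rcases i.2.1.lt_or_eq with hb | hb
    · exact Submodule.mem_sup_right (B.basis_mem_imBefore i hb)
    rcases (B.mem_kerTo_iff.1 hx i hi).lt_or_eq with hd | hd
    · refine Submodule.mem_sup_left (kerTo_le_kerBefore β hd (B.mem_kerTo_iff.2 fun j hj => ?_))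
      have : i = j := by
        by_contra hne
        exact hj (by simp [hne])
      rw [this]
    · exact absurd (DFunLike.congr_fun h0 ⟨i, hb, hd⟩) hi
  · intro hx'
    ext i
    rw [barCoord_apply, Finsupp.zero_apply]
    have hi : Alive b d β i := ⟨i.2.1.le, h.trans_eq i.2.2.symm⟩
    suffices H : kerBefore V β δ ⊔ imBefore V β ≤ LinearMap.ker ((B.basis β).coord ⟨i, hi⟩) from
      H hx'
    refine sup_le (iSup₂_le fun δ' hδ' y hy => ?_) (iSup₂_le fun r hr => ?_)
    · rw [LinearMap.mem_ker, Module.Basis.coord_apply]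
      by_contra hne
      exact (hδ'.trans_eq i.2.2.symm).not_ge (B.mem_kerTo_iff.1 hy _ hne)
    · rintro - ⟨y, rfl⟩
      exact B.repr_map_of_lt hr y _ i.2.1

/-- Two interval bases of a persistence module have the same intervals with the same multiplicities,
also when these are infinite. -/
theorem exists_equiv [Nontrivial R] {ι' : Type w'} {b' : ι' → T} {d' : ι' → WithTop T}
    (B' : IntervalBasis V b' d') (h : ∀ i, (b i : WithTop T) < d i)
    (h' : ∀ i, (b' i : WithTop T) < d' i) :
    ∃ σ : ι ≃ ι', ∀ i, b' (σ i) = b i ∧ d' (σ i) = d i := by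
  have key : ∀ p : T × WithTop T, Nonempty ({i // (b i, d i) = p} ≃ {i // (b' i, d' i) = p}) := by
    rintro ⟨β, δ⟩
    simp only [Prod.mk.injEq]
    by_cases hβ : (β : WithTop T) < δ
    · let e := (LinearMap.quotKerEquivOfSurjective _ (B.barCoord_surjective β δ hβ)).symm ≪≫ₗ
        Submodule.quotEquivOfEq _ _
          ((B.ker_barCoord β δ hβ).trans (B'.ker_barCoord β δ hβ).symm) ≪≫ₗ
        LinearMap.quotKerEquivOfSurjective _ (B'.barCoord_surjective β δ hβ)
      exact ⟨(Module.Basis.ofRepr (LinearEquiv.refl R _)).indexEquiv (Module.Basis.ofRepr e)⟩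
    · have : IsEmpty {i // b i = β ∧ d i = δ} :=
        ⟨fun i => hβ (by simpa [i.2.1, i.2.2] using h i)⟩
      have : IsEmpty {i // b' i = β ∧ d' i = δ} :=
        ⟨fun i => hβ (by simpa [i.2.1, i.2.2] using h' i)⟩
      exact ⟨Equiv.equivOfIsEmpty _ _⟩
  refine ⟨Equiv.ofFiberEquiv (f := fun i => (b i, d i)) (g := fun i => (b' i, d' i))
    fun p => (key p).some, fun i => ?_⟩
  have := Equiv.ofFiberEquiv_map (f := fun i => (b i, d i)) (g := fun i => (b' i, d' i))
    (fun p => (key p).some) i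
  exact Prod.ext_iff.1 this

end IntervalBasis

/-! ### Submodules of free modules over a PID -/

/-- A family is linearly independent if it is adapted to a filtration: `F p` contains all members of
degree less than `p`, and the members of degree `p` are linearly independent modulo `F p`. -/
theorem linearIndependent_of_filtration {R M ι P : Type*} [Ring R] [AddCommGroup M] [Module R M]
    [LinearOrder P] (deg : ι → P) (v : ι → M) (F : P → Submodule R M)
    (hF : ∀ p i, deg i < p → v i ∈ F p)
    (hv : ∀ p, LinearIndepOn R (fun i => (F p).mkQ (v i)) {i | deg i = p}) :
    LinearIndependent R v := by
  classical
  rw [linearIndependent_iff]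
  intro c hc
  by_contra hne
  obtain ⟨i, hi, hmax⟩ := c.support.exists_max_image deg (Finsupp.support_nonempty_iff.2 hne)
  have hsum : (F (deg i)).mkQ (Finsupp.linearCombination R v c) = 0 := by rw [hc, map_zero]
  rw [← Finsupp.filter_add_filter_not c (fun j => deg j = deg i), map_add, map_add] at hsum
  have h2 : (F (deg i)).mkQ (Finsupp.linearCombination R v (c.filter fun j => ¬ deg j = deg i)) =
      0 := by
    rw [Submodule.mkQ_apply, Submodule.Quotient.mk_eq_zero, Finsupp.linearCombination_apply]
    refine Submodule.sum_mem _ fun j hj => Submodule.smul_mem _ _ (hF _ _ ?_)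
    rw [Finsupp.support_filter, Finset.mem_filter] at hj
    exact (hmax j hj.1).lt_of_ne hj.2
  rw [h2, add_zero, Finsupp.apply_linearCombination] at hsum
  have h0 := linearIndepOn_iff.1 (hv (deg i)) _ (fun j hj => by
    rw [Finset.mem_coe, Finsupp.support_filter, Finset.mem_filter] at hj
    exact hj.2) hsum
  have := DFunLike.congr_fun h0 i
  rw [Finsupp.filter_apply_pos (fun j => deg j = deg i) _ rfl] at this
  exact Finsupp.mem_support_iff.1 hi this

/-- A submodule of a free module of any rank over a PID is free. -/
theorem free_submodule {R M : Type*} [CommRing R] [IsDomain R] [IsPrincipalIdealRing R]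
    [AddCommGroup M] [Module R M] [Module.Free R M] (N : Submodule R M) : Module.Free R N := by
  classical
  obtain ⟨ι, b⟩ := Module.Free.exists_basis (R := R) (M := M)
  obtain ⟨_, _⟩ := exists_wellFoundedLT ι
  let F (i : ι) : Submodule R M := ⨅ (j : ι) (_ : i ≤ j), LinearMap.ker (b.coord j)
  let G (i : ι) : Submodule R M := N ⊓ ⨅ (j : ι) (_ : i < j), LinearMap.ker (b.coord j)
  have memF {i : ι} {x : M} : x ∈ F i ↔ ∀ j, i ≤ j → b.repr x j = 0 := by
    simp [F, Submodule.mem_iInf]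
  have memG {i : ι} {x : M} : x ∈ G i ↔ x ∈ N ∧ ∀ j, i < j → b.repr x j = 0 := by
    simp [G, Submodule.mem_iInf]
  let a (i : ι) : Submodule R R := (G i).map (b.coord i)
  have ha (i : ι) : ∃ x ∈ G i, b.coord i x = Submodule.IsPrincipal.generator (a i) :=
    Submodule.mem_map.1 (Submodule.IsPrincipal.generator_mem (a i))
  choose x hxG hxg using ha
  let J := {i : ι // Submodule.IsPrincipal.generator (a i) ≠ 0}
  -- `x i` is an element of `N` with leading index at most `i` whose `i`-th coordinate generates the
  -- ideal of all such coordinates; those with a nonzero generator form a basis of `N`.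
  have hli : LinearIndependent R fun i : J => x i := by
    refine linearIndependent_of_filtration (fun i : J => (i : ι)) _ F (fun p i hi => ?_)
      fun p => ?_
    · exact memF.2 fun j hj => (memG.1 (hxG i)).2 j (hi.trans_le hj)
    · let f : (M ⧸ F p) →ₗ[R] R := (F p).liftQ (b.coord p) fun y hy => memF.1 hy p le_rfl
      refine LinearIndependent.of_comp f ?_
      have : Subsingleton {j : J | (j : ι) = p} :=
        ⟨fun j k => Subtype.ext (Subtype.ext (j.2.trans k.2.symm))⟩
      rw [linearIndependent_subsingleton_index_iff]
      rintro ⟨i, rfl⟩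
      exact (hxg i).trans_ne i.2
  have hspan (i : ι) : ∀ y ∈ G i, y ∈ Submodule.span R (Set.range fun i : J => x i) := by
    induction i using WellFoundedLT.induction with
    | ind i ih =>
    have below (y : M) (hy : y ∈ G i) (h0 : b.repr y i = 0) :
        y ∈ Submodule.span R (Set.range fun i : J => x i) := by
      by_cases hy0 : y = 0
      · rw [hy0]; exact zero_mem _
      have hne : (b.repr y).support.Nonempty := by
        rw [Finsupp.support_nonempty_iff]; simpa using hy0
      obtain ⟨j, hj, hmax⟩ := (b.repr y).support.exists_max_image id hne
      rw [Finsupp.mem_support_iff] at hj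
      have hji : j < i := by
        by_contra! hij
        rcases hij.lt_or_eq with h | rfl
        exacts [hj ((memG.1 hy).2 j h), hj h0]
      refine ih j hji y (memG.2 ⟨(memG.1 hy).1, fun k hk => ?_⟩)
      by_contra hk0
      exact (hmax k (Finsupp.mem_support_iff.2 hk0)).not_gt hk
    intro y hy
    obtain ⟨c, hc⟩ := (Submodule.IsPrincipal.mem_iff_eq_smul_generator (a i)).1
      (Submodule.mem_map_of_mem hy : b.coord i y ∈ a i)
    by_cases hg : Submodule.IsPrincipal.generator (a i) = 0
    · exact below y hy (by simpa [hg] using hc)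
    · have := below (y - c • x i) (sub_mem hy ((G i).smul_mem c (hxG i))) (by
        have := hxg i
        rw [Module.Basis.coord_apply] at this hc
        simp [this, hc])
      rw [← sub_add_cancel y (c • x i)]
      exact add_mem this (Submodule.smul_mem _ _ (Submodule.subset_span ⟨⟨i, hg⟩, rfl⟩))
  let v (i : J) : N := ⟨x i, (memG.1 (hxG i)).1⟩
  refine Module.Free.of_basis (Module.Basis.mk (v := v)
    (LinearIndependent.of_comp N.subtype hli) ?_)
  rintro ⟨y, hy⟩ -
  have hy' : y ∈ Submodule.span R (Set.range fun i : J => x i) := by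
    by_cases hy0 : y = 0
    · rw [hy0]; exact zero_mem _
    have hne : (b.repr y).support.Nonempty := by
      rw [Finsupp.support_nonempty_iff]; simpa using hy0
    obtain ⟨j, hj, hmax⟩ := (b.repr y).support.exists_max_image id hne
    refine hspan j y (memG.2 ⟨hy, fun k hk => ?_⟩)
    by_contra hk0
    exact (hmax k (Finsupp.mem_support_iff.2 hk0)).not_gt hk
  have : (Set.range fun i : J => x i) = N.subtype '' Set.range v := by
    rw [← Set.range_comp]; rfl
  rw [this, ← Submodule.map_span] at hy'
  obtain ⟨z, hz, hzy⟩ := hy'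
  rwa [← show z = ⟨y, hy⟩ from Subtype.ext hzy]

/-! ### Interval decomposition over a PID -/

section decomposition

variable {R : Type} [CommRing R] {T : Type v} [LinearOrder T] {V : T ⥤ ModuleCat.{u} R}

theorem kerTo_eq_bot {s : T} {δ : WithTop T} (h : δ ≤ s) : kerTo V s δ = ⊥ :=
  (Submodule.eq_bot_iff _).2 fun x hx =>
    (map_refl_apply le_rfl x).symm.trans (mem_kerTo.1 hx s le_rfl h)

theorem kerTo_top (s : T) : kerTo V s ⊤ = ⊤ :=
  top_le_iff.1 fun _ _ => mem_kerTo.2 fun _ _ h => absurd h (WithTop.coe_lt_top _).not_ge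

theorem mem_kerTo_coe {s t : T} (h : s ≤ t) {x : V.obj s} :
    x ∈ kerTo V s t ↔ V.map (homOfLE h) x = 0 := by
  refine ⟨fun hx => mem_kerTo.1 hx t h le_rfl, fun hx => mem_kerTo.2 fun t' ht' hδ => ?_⟩
  rw [← map_map_apply h (WithTop.coe_le_coe.1 hδ), hx, map_zero]

theorem exists_isGreatest [Finite T] {s : Set T} (hs : s.Nonempty) : ∃ p, IsGreatest s p := by
  obtain ⟨p, hp, h⟩ := s.exists_max_image id s.toFinite hs
  exact ⟨p, hp, h⟩

/-- With finitely many times, dying before `δ` means vanishing at the last time before `δ`. -/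
theorem mem_kerBefore_iff {β p : T} {δ : WithTop T} (hβ : β ≤ p)
    (hp : IsGreatest {t : T | (t : WithTop T) < δ} p) {x : V.obj β} :
    x ∈ kerBefore V β δ ↔ V.map (homOfLE hβ) x = 0 := by
  rw [← mem_kerTo_coe]
  have : kerBefore V β δ = kerTo V β p := by
    refine le_antisymm (iSup₂_le fun δ' hδ' => kerTo_mono β ?_) (kerTo_le_kerBefore β hp.1)
    obtain ⟨t, rfl⟩ := WithTop.ne_top_iff_exists.1 hδ'.ne_top
    exact WithTop.coe_le_coe.2 (hp.2 hδ')
  rw [this]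

theorem imBefore_eq_range {r s : T} (hr : IsGreatest {t : T | t < s} r) :
    imBefore V s = LinearMap.range (V.map (homOfLE hr.1.le)).hom := by
  refine le_antisymm (iSup₂_le fun t ht => ?_) ?_
  · rintro - ⟨y, rfl⟩
    exact ⟨V.map (homOfLE (hr.2 ht)) y, map_map_apply _ _ _⟩
  · rintro - ⟨y, rfl⟩
    exact map_mem_imBefore hr.1 y

/-- The subquotient of `V_β` that counts the intervals `[β, δ)` is free: if `p` is the last time
before `δ` and `r` the last time before `β`, it embeds into the cokernel of `V_r ⟶ V_p`. -/
theorem free_kerTo_quotient [IsDomain R] [IsPrincipalIdealRing R] [Finite T]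
    (hfree : ∀ t, Module.Free R (V.obj t))
    (hcok : ∀ (s t : T) (h : s ≤ t),
      Module.Free R (V.obj t ⧸ LinearMap.range (V.map (homOfLE h)).hom))
    (β : T) (δ : WithTop T) (h : (β : WithTop T) < δ) :
    Module.Free R
      (kerTo V β δ ⧸ (kerBefore V β δ ⊔ imBefore V β).comap (kerTo V β δ).subtype) := by
  obtain ⟨p, hp⟩ := exists_isGreatest (s := {t : T | (t : WithTop T) < δ}) ⟨β, h⟩
  have hβ : β ≤ p := hp.2 h
  -- If `β` is the least time, there is no `r`, and `V_p` itself takes the place of the cokernel.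
  obtain ⟨I, hI, hmem⟩ : ∃ I : Submodule R (V.obj p), Module.Free R (V.obj p ⧸ I) ∧
      ∀ x : V.obj β, x ∈ kerBefore V β δ ⊔ imBefore V β ↔ V.map (homOfLE hβ) x ∈ I := by
    rcases Set.eq_empty_or_nonempty {t : T | t < β} with he | hne
    · have : imBefore V β = ⊥ := by
        refine le_bot_iff.1 (iSup₂_le fun t ht => ?_)
        have : t ∈ {t : T | t < β} := ht
        simp [he] at this
      refine ⟨⊥, ?_, fun x => ?_⟩
      · have := hfree p
        exact Module.Free.of_equiv (Submodule.quotEquivOfEqBot ⊥ rfl).symm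
      · rw [this, sup_bot_eq, mem_kerBefore_iff hβ hp, Submodule.mem_bot]
    · obtain ⟨r, hr⟩ := exists_isGreatest hne
      have hrβ : r < β := hr.1
      refine ⟨_, hcok r p (hrβ.le.trans hβ), fun x => ?_⟩
      rw [imBefore_eq_range hr, Submodule.mem_sup]
      constructor
      · rintro ⟨y, hy, -, ⟨z, rfl⟩, rfl⟩
        refine ⟨z, ?_⟩
        have h1 := (mem_kerBefore_iff hβ hp).1 hy
        rw [map_add, h1, zero_add]
        exact (map_map_apply hrβ.le hβ z).symm
      · rintro ⟨z, hz⟩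
        refine ⟨x - V.map (homOfLE hrβ.le) z, ?_, _, ⟨z, rfl⟩, sub_add_cancel _ _⟩
        rw [mem_kerBefore_iff hβ hp, map_sub, map_map_apply, sub_eq_zero]
        exact hz.symm
  let f : kerTo V β δ →ₗ[R] V.obj p ⧸ I :=
    I.mkQ ∘ₗ (V.map (homOfLE hβ)).hom ∘ₗ (kerTo V β δ).subtype
  have hf : LinearMap.ker f = (kerBefore V β δ ⊔ imBefore V β).comap (kerTo V β δ).subtype := by
    ext x
    rw [Submodule.mem_comap, hmem, LinearMap.mem_ker]
    exact Submodule.Quotient.mk_eq_zero _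
  have := free_submodule (LinearMap.range f)
  rw [← hf]
  exact Module.Free.of_equiv f.quotKerEquivRange.symm

end decomposition

theorem ker_mapQ_map_eq_bot {R M M' : Type*} [Ring R] [AddCommGroup M] [Module R M]
    [AddCommGroup M'] [Module R M'] {f : M →ₗ[R] M'} {N : Submodule R M}
    (h : LinearMap.ker f ≤ N) :
    LinearMap.ker (N.mapQ (N.map f) f (Submodule.le_comap_map f N)) = ⊥ := by
  rw [Submodule.ker_mapQ, Submodule.comap_map_eq, sup_eq_left.2 h, Submodule.mkQ_map_self]

/-- A persistence module over a PID with finitely many times, free modules and free cokernels has an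
interval basis. The ranks may be infinite. -/
theorem exists_intervalBasis {R : Type} [CommRing R] [IsDomain R] [IsPrincipalIdealRing R]
    {T : Type} [LinearOrder T] [Finite T] {V : T ⥤ ModuleCat.{u} R}
    (hfree : ∀ t, Module.Free R (V.obj t))
    (hcok : ∀ (s t : T) (h : s ≤ t),
      Module.Free R (V.obj t ⧸ LinearMap.range (V.map (homOfLE h)).hom)) :
    ∃ (ι : Type u) (b : ι → T) (d : ι → WithTop T), (∀ i, (b i : WithTop T) < d i) ∧
      Nonempty (IntervalBasis V b d) := by
  classical
  -- The generators `w p k` of the intervals `[β, δ)`, `p = (β, δ)`, lift a basis of the subquotient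
  -- of `V_β` that counts them.
  have lifts : ∀ p : {p : T × WithTop T // (p.1 : WithTop T) < p.2}, ∃ (κ : Type u)
      (w : κ → V.obj p.1.1), (∀ k, w k ∈ kerTo V p.1.1 p.1.2) ∧
      LinearIndependent R (fun k => (kerBefore V p.1.1 p.1.2 ⊔ imBefore V p.1.1).mkQ (w k)) ∧
      kerTo V p.1.1 p.1.2 ≤
        Submodule.span R (Set.range w) ⊔ (kerBefore V p.1.1 p.1.2 ⊔ imBefore V p.1.1) := by
    rintro ⟨⟨β, δ⟩, h⟩
    have := free_kerTo_quotient hfree hcok β δ h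
    set N := kerBefore V β δ ⊔ imBefore V β
    set N' := N.comap (kerTo V β δ).subtype
    let B := Module.Free.chooseBasis R (kerTo V β δ ⧸ N')
    choose w hw using fun k => N'.mkQ_surjective (B k)
    refine ⟨_, fun k => w k, fun k => (w k).2, ?_, fun x hx => ?_⟩
    · have := B.linearIndependent.map' (N'.mapQ N (kerTo V β δ).subtype le_rfl) (by
        rw [Submodule.ker_mapQ]; simp [N'])
      have he : N'.mapQ N (kerTo V β δ).subtype le_rfl ∘ B = fun k => N.mkQ (w k) :=
        funext fun k => by rw [Function.comp_apply, ← hw k]; rfl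
      rw [he] at this
      exact this
    · have hx' : N'.mkQ ⟨x, hx⟩ ∈ (Submodule.span R (Set.range w)).map N'.mkQ := by
        rw [Submodule.map_span, ← Set.range_comp]
        have : (N'.mkQ ∘ w) = B := funext hw
        rw [this, B.span_eq]; trivial
      obtain ⟨y, hy, hxy⟩ := hx'
      have hy' : (y : V.obj β) ∈ Submodule.span R (Set.range fun k => (w k : V.obj β)) := by
        have := Submodule.mem_map_of_mem (f := (kerTo V β δ).subtype) hy
        rwa [Submodule.map_span, ← Set.range_comp] at this
      refine Submodule.mem_sup.2 ⟨y, hy', x - y, ?_, add_sub_cancel _ _⟩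
      have := (Submodule.Quotient.eq N').1 hxy.symm
      exact this
  choose κ w hwk hwli hwspan using lifts
  let ι := Σ p, κ p
  let b (i : ι) : T := i.1.1.1
  let d (i : ι) : WithTop T := i.1.1.2
  let vec (s : T) (i : {i : ι // Alive b d s i}) : V.obj s := V.map (homOfLE i.2.1) (w i.1.1 i.1.2)
  have hmap (r s : T) (h : r ≤ s) (i : {i : ι // Alive b d r i}) : V.map (homOfLE h) (vec r i) =
      if hs : Alive b d s i then vec s ⟨i, hs⟩ else 0 := by
    have h1 : V.map (homOfLE h) (vec r i) = V.map (homOfLE (i.2.1.trans h)) (w i.1.1 i.1.2) :=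
      map_map_apply _ _ _
    rw [h1]
    split_ifs with hs
    · rfl
    · exact mem_kerTo.1 (hwk _ _) s _ (not_lt.1 fun hlt => hs ⟨i.2.1.trans h, hlt⟩)
  -- Spanning: by induction on the time `s`, and for fixed `s` on the time of death `δ`.
  have hspan (s : T) : ∀ δ, kerTo V s δ ≤ Submodule.span R (Set.range (vec s)) := by
    induction s using WellFoundedLT.induction with
    | ind s ihs =>
    intro δ
    induction δ using WellFoundedLT.induction with
    | ind δ ihδ =>
    rcases le_or_gt δ s with hδ | hδ
    · rw [kerTo_eq_bot hδ]; exact bot_le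
    · refine (hwspan ⟨(s, δ), hδ⟩).trans
        (sup_le ?_ (sup_le (iSup₂_le ihδ) (iSup₂_le fun r hr => ?_)))
      · rw [Submodule.span_le]
        rintro - ⟨k, rfl⟩
        exact Submodule.subset_span ⟨⟨⟨⟨(s, δ), hδ⟩, k⟩, le_rfl, hδ⟩, map_refl_apply _ _⟩
      · rw [LinearMap.range_eq_map, ← kerTo_top]
        refine (Submodule.map_mono (ihs r hr ⊤)).trans ?_
        rw [Submodule.map_span, Submodule.span_le]
        rintro - ⟨-, ⟨i, rfl⟩, rfl⟩
        have := hmap r s hr.le i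
        rw [SetLike.mem_coe]
        rw [show (V.map (homOfLE hr.le)).hom (vec r i) = _ from this]
        split_ifs
        · exact Submodule.subset_span ⟨_, rfl⟩
        · exact zero_mem _
  -- Independence at time `s`: filter `V_s` by the lexicographic order of (birth, death).
  have hli (s : T) : LinearIndependent R (vec s) := by
    let P := {p : T ×ₗ WithTop T // (ofLex p).1 ≤ s ∧ (s : WithTop T) < (ofLex p).2}
    let F (p : P) : Submodule R (V.obj s) :=
      (kerBefore V (ofLex p.1).1 (ofLex p.1).2 ⊔ imBefore V (ofLex p.1).1).map
        (V.map (homOfLE p.2.1)).hom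
    refine linearIndependent_of_filtration
      (fun i : {i : ι // Alive b d s i} => (⟨toLex (b i, d i), i.2⟩ : P)) _ F ?_ ?_
    · rintro ⟨p, h1, h2⟩ ⟨⟨⟨⟨β, δ⟩, h⟩, k⟩, hi1, hi2⟩ hlt
      rcases Prod.Lex.lt_iff.1 (show toLex (β, δ) < p from hlt) with hβ | ⟨hβ, hδ⟩
      · exact ⟨_, Submodule.mem_sup_right (map_mem_imBefore hβ (w ⟨(β, δ), h⟩ k)),
          map_map_apply _ _ _⟩
      · obtain ⟨β', δ'⟩ := p
        change β = β' at hβ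
        subst hβ
        exact ⟨_, Submodule.mem_sup_left (kerTo_le_kerBefore _ hδ (hwk ⟨(β, δ), h⟩ k)), rfl⟩
    · rintro ⟨⟨β, δ⟩, h1, h2⟩
      have hβδ : (β : WithTop T) < δ := (WithTop.coe_le_coe.2 h1).trans_lt h2
      let N := kerBefore V β δ ⊔ imBefore V β
      let e : κ ⟨(β, δ), hβδ⟩ → {i : {i : ι // Alive b d s i} |
          (⟨toLex (b i, d i), i.2⟩ : P) = ⟨toLex (β, δ), h1, h2⟩} :=
        fun k => ⟨⟨⟨⟨(β, δ), hβδ⟩, k⟩, h1, h2⟩, rfl⟩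
      have he : Function.Bijective e := by
        constructor
        · intro k l hkl
          exact eq_of_heq (Sigma.mk.inj
            (congrArg (fun x => ((x : {i : ι // Alive b d s i}) : ι)) (congrArg Subtype.val hkl))).2
        · rintro ⟨⟨⟨⟨⟨β', δ'⟩, h'⟩, k⟩, ha⟩, heq⟩
          have heq' := congrArg ofLex (congrArg Subtype.val heq)
          change (β', δ') = (β, δ) at heq'
          obtain ⟨rfl, rfl⟩ := Prod.mk.inj heq'
          exact ⟨k, rfl⟩
      refine (linearIndependent_equiv (Equiv.ofBijective e he)).1 ?_
      have hker : LinearMap.ker (V.map (homOfLE h1)).hom ≤ N :=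
        le_sup_of_le_left (le_trans (fun x hx => (mem_kerTo_coe h1).2 hx)
          (kerTo_le_kerBefore β h2))
      exact (hwli ⟨(β, δ), hβδ⟩).map' _ (ker_mapQ_map_eq_bot hker)
  refine ⟨ι, b, d, fun i => i.1.2, ⟨⟨fun s => Module.Basis.mk (hli s) ?_, fun r s h i => ?_⟩⟩⟩
  · rw [← kerTo_top s]; exact hspan s ⊤
  · simp only [Module.Basis.mk_apply]
    exact hmap r s h i

/-! ### Pseudo-inverses and extension of scalars -/

section universalCoefficients
open Limits

/-- If `f` has a pseudo-inverse `g`, that is `f ≫ g ≫ f = f`, then its kernel is the image of the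
idempotent `1 - f ≫ g`, so every additive functor preserves it. -/
theorem preservesKernel_of_pseudoinverse {C D : Type*} [Category* C] [Category* D] [Preadditive C]
    [Preadditive D] (F : C ⥤ D) [F.Additive] {X Y : C} (f : X ⟶ Y) [HasKernel f] (g : Y ⟶ X)
    (h : f ≫ g ≫ f = f) : PreservesLimit (parallelPair f 0) F := by
  let r : X ⟶ kernel f := kernel.lift f (𝟙 X - f ≫ g) (by simp [h])
  have hr : r ≫ kernel.ι f = 𝟙 X - f ≫ g := kernel.lift_ι _ _ _
  have hr' : kernel.ι f ≫ r = 𝟙 _ := by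
    rw [← cancel_mono (kernel.ι f)]
    simp [hr]
  refine preservesLimit_of_preserves_limit_cone (kernelIsKernel f) ?_
  refine (isLimitMapConeForkEquiv' F (kernel.condition f)).symm ?_
  have : Mono (F.map (kernel.ι f)) := by
    have : IsSplitMono (F.map (kernel.ι f)) := ⟨⟨F.map r, by rw [← F.map_comp, hr', F.map_id]⟩⟩
    infer_instance
  refine KernelFork.IsLimit.ofι' _ _ (fun {W} k hk => ⟨k ≫ F.map r, ?_⟩)
  rw [Category.assoc, ← F.map_comp, hr, F.map_sub, F.map_id, F.map_comp, Preadditive.comp_sub,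
    Category.comp_id, reassoc_of% hk, zero_comp, sub_zero]

/-- The kernel of `e` is a direct summand of `B` and the image of `d` one of `ker e`, as the
quotients are free; the projections, followed by a section of `d`, give a pseudo-inverse. -/
theorem exists_linear_pseudoinverse {R A B C : Type*} [CommRing R] [IsDomain R]
    [IsPrincipalIdealRing R] [AddCommGroup A] [Module R A] [AddCommGroup B] [Module R B]
    [AddCommGroup C] [Module R C] [Module.Free R B] [Module.Free R C] (e : B →ₗ[R] C)
    (d : A →ₗ[R] LinearMap.ker e) [Module.Free R (LinearMap.ker e ⧸ LinearMap.range d)] :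
    ∃ g : B →ₗ[R] A, ∀ a, d (g (d a)) = d a := by
  have := free_submodule (LinearMap.range e)
  have := free_submodule (LinearMap.ker e)
  have := free_submodule (LinearMap.range d)
  obtain ⟨s, hs⟩ := Module.projective_lifting_property e.rangeRestrict LinearMap.id
    e.surjective_rangeRestrict
  obtain ⟨t, ht⟩ := Module.projective_lifting_property (LinearMap.range d).mkQ LinearMap.id
    (Submodule.mkQ_surjective _)
  obtain ⟨r, hr⟩ := Module.projective_lifting_property d.rangeRestrict LinearMap.id
    d.surjective_rangeRestrict
  -- `ρ` projects `B` onto `ker e`, and `τ` projects `ker e` onto the image of `d`.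
  let ρ : B →ₗ[R] LinearMap.ker e := (LinearMap.id - s ∘ₗ e.rangeRestrict).codRestrict _ fun x => by
    have := congrArg Subtype.val (LinearMap.congr_fun hs (e.rangeRestrict x))
    simp only [LinearMap.comp_apply, LinearMap.id_apply, LinearMap.codRestrict_apply] at this
    rw [LinearMap.mem_ker, LinearMap.sub_apply, map_sub, sub_eq_zero]
    exact this.symm
  let τ : LinearMap.ker e →ₗ[R] LinearMap.range d :=
    (LinearMap.id - t ∘ₗ (LinearMap.range d).mkQ).codRestrict _ fun x => by
      refine (Submodule.Quotient.mk_eq_zero _).1 ?_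
      rw [← Submodule.mkQ_apply, LinearMap.sub_apply, map_sub, sub_eq_zero]
      exact (LinearMap.congr_fun ht ((LinearMap.range d).mkQ x)).symm
  have hρ (z : LinearMap.ker e) : ρ z = z := by
    apply Subtype.ext
    have : e.rangeRestrict z = 0 := Subtype.ext z.2
    simp [ρ, this]
  have hτ (a : A) : τ (d a) = d.rangeRestrict a := by
    apply Subtype.ext
    have : (LinearMap.range d).mkQ (d a) = 0 := by
      rw [Submodule.mkQ_apply, Submodule.Quotient.mk_eq_zero]; exact ⟨a, rfl⟩
    simp [τ, -Submodule.mkQ_apply, this]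
  refine ⟨r ∘ₗ τ ∘ₗ ρ, fun a => ?_⟩
  rw [LinearMap.comp_apply, LinearMap.comp_apply, hρ, hτ]
  exact congrArg Subtype.val (LinearMap.congr_fun hr (d.rangeRestrict a))

/-- In a complex of free modules over a PID, the differential out of degree `q` has a pseudo-inverse
if the homology in degree `q - 1` is free. -/
theorem exists_pseudoinverse_d {R : Type} [CommRing R] [IsDomain R] [IsPrincipalIdealRing R]
    (C : ChainComplex (ModuleCat.{u} R) ℕ) (hC : ∀ n, Module.Free R (C.X n)) (q : ℕ)
    (hq : ∀ p, p + 1 = q → Module.Free R (C.homology p)) :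
    ∃ g, (C.sc q).g ≫ g ≫ (C.sc q).g = (C.sc q).g := by
  rcases q with _ | p
  · refine ⟨0, ?_⟩
    have : (C.sc 0).g = 0 := C.shape _ _ (by simp)
    rw [this]
    exact zero_comp
  · have hfree : Module.Free R (C.sc p).homology := hq p rfl
    have : Module.Free R
        (LinearMap.ker (C.sc p).g.hom ⧸ LinearMap.range (C.sc p).moduleCatToCycles) :=
      Module.Free.of_equiv ((C.sc p).moduleCatHomologyIso.toLinearEquiv)
    have : Module.Free R (C.sc p).X₂ := hC _
    have : Module.Free R (C.sc p).X₃ := hC _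
    obtain ⟨g, hg⟩ := exists_linear_pseudoinverse (C.sc p).g.hom (C.sc p).moduleCatToCycles
    have h : ∃ g, (C.sc p).f ≫ g ≫ (C.sc p).f = (C.sc p).f :=
      ⟨ModuleCat.ofHom g, by ext a; exact congrArg Subtype.val (hg a)⟩
    have key : ∀ (i j i' j' : ℕ) (_ : i = i') (_ : j = j'),
        (∃ g, C.d i j ≫ g ≫ C.d i j = C.d i j) → ∃ g, C.d i' j' ≫ g ≫ C.d i' j' = C.d i' j' := by
      rintro i j _ _ rfl rfl h
      exact h
    exact key _ _ _ _ (ChainComplex.prev ℕ p) (ChainComplex.next_nat_succ p).symm h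

instance extendScalars_additive {R S : Type} [CommRing R] [CommRing S] (f : R →+* S) :
    (ModuleCat.extendScalars.{0, 0, u} f).Additive :=
  (ModuleCat.extendRestrictScalarsAdj f).left_adjoint_additive

variable {R S : Type} [CommRing R] [CommRing S] (f : R →+* S)

theorem preservesLeftHomologyOf_of_pseudoinverse (Sc : ShortComplex (ModuleCat.{u} R))
    (h : ∃ g, Sc.g ≫ g ≫ Sc.g = Sc.g) :
    (ModuleCat.extendScalars.{0, 0, u} f).PreservesLeftHomologyOf Sc := by
  obtain ⟨g, hg⟩ := h
  have := preservesKernel_of_pseudoinverse (ModuleCat.extendScalars.{0, 0, u} f) _ g hg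
  have : Sc.leftHomologyData.IsPreservedBy (ModuleCat.extendScalars.{0, 0, u} f) :=
    { g := this
      f' := inferInstance }
  exact Functor.PreservesLeftHomologyOf.mk' _ Sc.leftHomologyData

/-- The basis `1 ⊗ B i` of `S ⊗ M`. -/
def extendScalarsBasis {M : ModuleCat.{u} R} {ι : Type w} (B : Module.Basis ι R M) :
    Module.Basis ι S ((ModuleCat.extendScalars.{0, 0, u} f).obj M) :=
  letI := f.toAlgebra
  (B.baseChange S : Module.Basis ι S (TensorProduct R S M))

theorem extendScalarsBasis_apply {M : ModuleCat.{u} R} {ι : Type w} (B : Module.Basis ι R M)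
    (i : ι) :
    extendScalarsBasis f B i = (ModuleCat.extendRestrictScalarsAdj f).unit.app M (B i) := by
  let := f.toAlgebra
  exact B.baseChange_apply S i

end universalCoefficients

/-! ### Singular chains and homology under change of coefficients -/

section chains
open Limits Simplicial

variable {R S : Type} [CommRing R] [CommRing S] (f : R →+* S)

/-- The isomorphism `S ⊗ R ≅ S` of coefficient modules. -/
def extendScalarsCoeffIso :
    (ModuleCat.extendScalars.{0, 0, u} f).obj (coeff.{u} R) ≅ coeff.{u} S :=
  ((extendScalarsBasis f ((Module.Basis.singleton Unit R).map ULift.moduleEquiv.symm)).equiv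
    ((Module.Basis.singleton Unit S).map ULift.moduleEquiv.symm) (Equiv.refl _)).toModuleIso

/-- The isomorphism `S ⊗ C_n(Y; R) ≅ C_n(Y; S)`: extension of scalars preserves coproducts. -/
def extendScalarsChainsXIso (Y : SSet.{u}) (n : ℕ) :
    (ModuleCat.extendScalars.{0, 0, u} f).obj ((Y.chainComplex (coeff.{u} R)).X n) ≅
      (Y.chainComplex (coeff.{u} S)).X n :=
  (isColimitCofanMkObjOfIsColimit (ModuleCat.extendScalars.{0, 0, u} f) _ _
    (Y.isColimitChainComplexXCofan (coeff.{u} R) n)).coconePointsIsoOfNatIso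
    (Y.isColimitChainComplexXCofan (coeff.{u} S) n)
    (Discrete.natIso fun _ => extendScalarsCoeffIso f)

theorem ι_extendScalarsChainsXIso_hom (Y : SSet.{u}) (n : ℕ) (x : Y _⦋n⦌) :
    (ModuleCat.extendScalars.{0, 0, u} f).map (Y.ιChainComplex (R := coeff.{u} R) x) ≫
      (extendScalarsChainsXIso f Y n).hom =
      (extendScalarsCoeffIso f).hom ≫ Y.ιChainComplex (R := coeff.{u} S) x :=
  IsColimit.comp_coconePointsIsoOfNatIso_hom
    (isColimitCofanMkObjOfIsColimit (ModuleCat.extendScalars.{0, 0, u} f) _ _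
    (Y.isColimitChainComplexXCofan (coeff.{u} R) n))
    (Y.isColimitChainComplexXCofan (coeff.{u} S) n)
    (Discrete.natIso fun _ => extendScalarsCoeffIso f) ⟨x⟩

theorem extendScalars_chains_hom_ext {Y : SSet.{u}} {n : ℕ} {M : ModuleCat.{u} S}
    {g h : (ModuleCat.extendScalars.{0, 0, u} f).obj
      ((Y.chainComplex (coeff.{u} R)).X n) ⟶ M}
    (H : ∀ x : Y _⦋n⦌,
      (ModuleCat.extendScalars.{0, 0, u} f).map (Y.ιChainComplex (R := coeff.{u} R) x) ≫ g =
      (ModuleCat.extendScalars.{0, 0, u} f).map (Y.ιChainComplex (R := coeff.{u} R) x) ≫ h) :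
    g = h :=
  (isColimitCofanMkObjOfIsColimit (ModuleCat.extendScalars.{0, 0, u} f) _ _
    (Y.isColimitChainComplexXCofan (coeff.{u} R) n)).hom_ext fun x => H x.as

/-- The isomorphism of complexes `S ⊗ C_•(Y; R) ≅ C_•(Y; S)`. -/
def extendScalarsChainsIso (Y : SSet.{u}) :
    ((ModuleCat.extendScalars.{0, 0, u} f).mapHomologicalComplex _).obj
      (Y.chainComplex (coeff.{u} R)) ≅ Y.chainComplex (coeff.{u} S) :=
  HomologicalComplex.Hom.isoOfComponents (extendScalarsChainsXIso f Y) <| by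
    rintro - n rfl
    refine extendScalars_chains_hom_ext f fun x => ?_
    change (ModuleCat.extendScalars.{0, 0, u} f).map (Y.ιChainComplex x) ≫
        (extendScalarsChainsXIso f Y (n + 1)).hom ≫ (Y.chainComplex (coeff.{u} S)).d (n + 1) n =
      (ModuleCat.extendScalars.{0, 0, u} f).map (Y.ιChainComplex x) ≫
        (ModuleCat.extendScalars.{0, 0, u} f).map ((Y.chainComplex (coeff.{u} R)).d (n + 1) n) ≫
          (extendScalarsChainsXIso f Y n).hom
    rw [← Category.assoc, ι_extendScalarsChainsXIso_hom, Category.assoc, SSet.ιChainComplex_d,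
      ← Category.assoc, ← Functor.map_comp, SSet.ιChainComplex_d, Functor.map_sum,
      Preadditive.comp_sum, Preadditive.sum_comp]
    refine Finset.sum_congr rfl fun i _ => ?_
    rw [Functor.map_zsmul, Preadditive.comp_zsmul, Preadditive.zsmul_comp,
      ι_extendScalarsChainsXIso_hom]

theorem extendScalarsChainsIso_naturality {Y Z : SSet.{u}} (φ : Y ⟶ Z) :
    ((ModuleCat.extendScalars.{0, 0, u} f).mapHomologicalComplex _).map
      (SSet.chainComplexMap φ (coeff.{u} R)) ≫ (extendScalarsChainsIso f Z).hom =
    (extendScalarsChainsIso f Y).hom ≫ SSet.chainComplexMap φ (coeff.{u} S) := by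
  ext n : 1
  refine extendScalars_chains_hom_ext f fun x => ?_
  change (ModuleCat.extendScalars.{0, 0, u} f).map (Y.ιChainComplex x) ≫
      (ModuleCat.extendScalars.{0, 0, u} f).map ((SSet.chainComplexMap φ (coeff.{u} R)).f n) ≫
        (extendScalarsChainsXIso f Z n).hom =
    (ModuleCat.extendScalars.{0, 0, u} f).map (Y.ιChainComplex x) ≫
      (extendScalarsChainsXIso f Y n).hom ≫ (SSet.chainComplexMap φ (coeff.{u} S)).f n
  rw [← Category.assoc, ← Functor.map_comp, SSet.ι_chainComplexMap_f,
    ι_extendScalarsChainsXIso_hom, ← Category.assoc, ι_extendScalarsChainsXIso_hom, Category.assoc,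
    SSet.ι_chainComplexMap_f]

theorem free_chains (Y : SSet.{u}) (n : ℕ) :
    Module.Free R ((Y.chainComplex (coeff.{u} R)).X n) := by
  classical
  have : Module.Free R (⨁ _ : Y _⦋n⦌, coeff.{u} R) := Module.Free.dfinsupp _ _
  exact Module.Free.of_equiv
    (ModuleCat.coprodIsoDirectSum fun _ : Y _⦋n⦌ => coeff.{u} R).toLinearEquiv.symm

/-- The isomorphism `H_q(Y; S) ≅ S ⊗ H_q(Y; R)`, when extension of scalars preserves the homology of
`C_•(Y; R)` in degree `q`. -/
def homologyIso (Y : SSet.{u}) (q : ℕ)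
    [(ModuleCat.extendScalars.{0, 0, u} f).PreservesLeftHomologyOf
      ((Y.chainComplex (coeff.{u} R)).sc q)] :
    (Y.chainComplex (coeff.{u} S)).homology q ≅
      (ModuleCat.extendScalars.{0, 0, u} f).obj ((Y.chainComplex (coeff.{u} R)).homology q) :=
  HomologicalComplex.homologyMapIso (extendScalarsChainsIso f Y).symm q ≪≫
    ((Y.chainComplex (coeff.{u} R)).sc q).mapHomologyIso (ModuleCat.extendScalars.{0, 0, u} f)

theorem homologyIso_naturality {Y Z : SSet.{u}} (φ : Y ⟶ Z) (q : ℕ)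
    [(ModuleCat.extendScalars.{0, 0, u} f).PreservesLeftHomologyOf
      ((Y.chainComplex (coeff.{u} R)).sc q)]
    [(ModuleCat.extendScalars.{0, 0, u} f).PreservesLeftHomologyOf
      ((Z.chainComplex (coeff.{u} R)).sc q)] :
    SSet.homologyMap φ (coeff.{u} S) q ≫ (homologyIso f Z q).hom =
      (homologyIso f Y q).hom ≫
        (ModuleCat.extendScalars.{0, 0, u} f).map (SSet.homologyMap φ (coeff.{u} R) q) := by
  have h1 := (CommSq.mk (extendScalarsChainsIso_naturality f φ)).vert_inv.map
    (HomologicalComplex.homologyFunctor _ _ q)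
  have h2 := CommSq.mk (ShortComplex.mapHomologyIso_hom_naturality
    ((HomologicalComplex.shortComplexFunctor _ _ q).map (SSet.chainComplexMap φ (coeff.{u} R)))
    (ModuleCat.extendScalars.{0, 0, u} f))
  exact (h1.vert_comp h2).w

theorem preservesLeftHomologyOf_chains [IsDomain R] [IsPrincipalIdealRing R] (Y : SSet.{u}) (q : ℕ)
    (hq : ∀ p, p + 1 = q → Module.Free R ((Y.chainComplex (coeff.{u} R)).homology p)) :
    (ModuleCat.extendScalars.{0, 0, u} f).PreservesLeftHomologyOf
      ((Y.chainComplex (coeff.{u} R)).sc q) :=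
  preservesLeftHomologyOf_of_pseudoinverse f _
    (exists_pseudoinverse_d _ (free_chains Y) q hq)

variable {T : Type v} [Preorder T] {E : Type u} [TopologicalSpace E] (X : T → Set E)
  (hX : Monotone X) (q : ℕ)

/-- If `H_{q-1}(X_t; R)` is free for all `t`, an interval basis of the persistent homology over `R`
induces one over `S` with the same intervals. -/
def IntervalBasis.extendScalars [IsDomain R] [IsPrincipalIdealRing R]
    (hq : ∀ p, p + 1 = q → ∀ t, Module.Free R ((homology R p).obj (TopCat.of (X t))))
    {ι : Type w} {b : ι → T} {d : ι → WithTop T}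
    (B : IntervalBasis (persistentHomology R q X hX) b d) :
    IntervalBasis (persistentHomology S q X hX) b d :=
  have (t : T) := preservesLeftHomologyOf_chains f (TopCat.toSSet.obj (TopCat.of (X t))) q
    fun p hp => hq p hp t
  { basis s := (extendScalarsBasis f (B.basis s)).map
      (homologyIso f (TopCat.toSSet.obj (TopCat.of (X s))) q).symm.toLinearEquiv
    map_basis s t h i := by
      have key : (persistentHomology S q X hX).map (homOfLE h) ≫
          (homologyIso f (TopCat.toSSet.obj (TopCat.of (X t))) q).hom =
          (homologyIso f (TopCat.toSSet.obj (TopCat.of (X s))) q).hom ≫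
          (ModuleCat.extendScalars.{0, 0, u} f).map
            ((persistentHomology R q X hX).map (homOfLE h)) :=
        homologyIso_naturality f (TopCat.toSSet.map (inclusion (hX h))) q
      have key' := ConcreteCategory.congr_hom (CommSq.mk key).vert_inv.w
        (extendScalarsBasis f (B.basis s) i)
      refine key'.symm.trans ?_
      have hnat := ConcreteCategory.congr_hom
        ((ModuleCat.extendRestrictScalarsAdj f).unit.naturality
          ((persistentHomology R q X hX).map (homOfLE h))) (B.basis s i)
      change (homologyIso f (TopCat.toSSet.obj (TopCat.of (X t))) q).inv
        ((ModuleCat.extendScalars.{0, 0, u} f).map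
          ((persistentHomology R q X hX).map (homOfLE h)) (extendScalarsBasis f (B.basis s) i)) = _
      rw [extendScalarsBasis_apply]
      refine (congrArg _ hnat.symm).trans ?_
      change (homologyIso f (TopCat.toSSet.obj (TopCat.of (X t))) q).inv
        ((ModuleCat.extendRestrictScalarsAdj f).unit.app _
          ((persistentHomology R q X hX).map (homOfLE h) (B.basis s i))) = _
      rw [B.map_basis]
      split_ifs with ht
      · exact congrArg _ (extendScalarsBasis_apply f (B.basis t) ⟨i, ht⟩).symm
      · exact (congrArg _ (map_zero
          ((ModuleCat.extendRestrictScalarsAdj f).unit.app _).hom)).trans (map_zero _) }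

end chains

/-! ### Exact sequence of a pair, empty space, subcomplexes, and change of the time axis -/

section topology
open Limits

theorem mono_inclusion {E : Type u} [TopologicalSpace E] {A B : Set E} (h : A ⊆ B) :
    Mono (inclusion h) :=
  (TopCat.mono_iff_injective _).2 (Set.inclusion_injective h)

/-- By the exact sequence of the pair `(B, A)`, the cokernel of `H_q(A) ⟶ H_q(B)` embeds into
`H_q(B, A)`. -/
theorem free_quotient_range_of_free_relativeHomology {R : Type} [CommRing R] [IsDomain R]
    [IsPrincipalIdealRing R] (q : ℕ) {E : Type u} [TopologicalSpace E] {A B : Set E} (h : A ⊆ B)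
    (hfree : Module.Free R (relativeHomology R q h)) :
    Module.Free R ((homology R q).obj (TopCat.of B) ⧸
      LinearMap.range ((homology R q).map (inclusion h)).hom) := by
  have := mono_inclusion h
  have : HasPullbacks (ModuleCat.{u} R) := Abelian.hasPullbacks
  let S : ShortComplex (ChainComplex (ModuleCat.{u} R) ℕ) :=
    ShortComplex.mk ((chains R).map (inclusion h)) (cokernel.π _) (cokernel.condition _)
  have hS : S.ShortExact :=
    { exact := ShortComplex.exact_cokernel _
      mono_f := inferInstanceAs (Mono ((chains R).map (inclusion h)))
      epi_g := inferInstanceAs (Epi (cokernel.π _)) }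
  have hex := (hS.homology_exact₂ q).moduleCat_range_eq_ker
  let g := (HomologicalComplex.homologyMap S.g q).hom
  have hfree' : Module.Free R (S.X₃.homology q) := hfree
  have := free_submodule (LinearMap.range g)
  exact Module.Free.of_equiv
    ((Submodule.quotEquivOfEq _ _ hex).trans g.quotKerEquivRange).symm

theorem isZero_homology_of_isEmpty {R : Type} [CommRing R] (q : ℕ) (Y : TopCat.{u}) [IsEmpty Y] :
    IsZero ((homology R q).obj Y) := by
  by_cases hq : q = 0
  · subst hq
    refine IsZero.of_iso ?_
      (AlgebraicTopology.singularHomologyFunctorZeroOfTotallyDisconnectedSpace _ (coeff.{u} R) Y)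
    exact (IsZero.iff_id_eq_zero _).2 (Sigma.hom_ext _ _ fun y => isEmptyElim y)
  · exact AlgebraicTopology.isZero_singularHomologyFunctor_of_totallyDisconnectedSpace _ _ _ _ hq

theorem isIso_inclusion {E : Type u} [TopologicalSpace E] {A B : Set E} (h : A ⊆ B) (hAB : A = B) :
    IsIso (inclusion h) := by
  subst hAB
  exact inferInstanceAs (IsIso (𝟙 (TopCat.of A)))

theorem finite_subcomplex {E : Type u} [TopologicalSpace E] [T2Space E] (C : Set E)
    [Topology.CWComplex C] [Topology.CWComplex.Finite C] :
    Finite (Topology.CWComplex.Subcomplex C) := by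
  have : Finite (Σ n, Topology.RelCWComplex.cell C n) :=
    Topology.RelCWComplex.finite_cells_of_finite
  refine Finite.of_injective (β := Set (Σ n, Topology.RelCWComplex.cell C n))
    (fun F => {j | j.2 ∈ F.I j.1}) fun F G h => ?_
  have hI : F.I = G.I := by
    ext n j
    exact Set.ext_iff.1 h ⟨n, j⟩
  apply SetLike.coe_injective
  change F.carrier = G.carrier
  rw [← F.union', ← G.union', hI]

end topology

section reindex

variable {R : Type} [CommRing R]

theorem IntervalBasis.bot_lt {T : Type v} [PartialOrder T] [OrderBot T] {V : T ⥤ ModuleCat.{u} R}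
    [Nontrivial R] {ι : Type w} {b : ι → T} {d : ι → WithTop T} (B : IntervalBasis V b d)
    (hV : Subsingleton (V.obj ⊥)) (i : ι) (hi : (b i : WithTop T) < d i) : ⊥ < b i := by
  rw [bot_lt_iff_ne_bot]
  intro hb
  have hA : Alive b d ⊥ i := ⟨hb.le, by rwa [← hb]⟩
  exact (B.basis ⊥).ne_zero ⟨i, hA⟩ (Subsingleton.elim _ _)

variable {T : Type v} [LinearOrder T] {P : Type} [LinearOrder P]

theorem alive_map_iff {a : P → T} {l : T → P} (ha : GaloisConnection a l)
    {ι : Type w} {b : ι → P} {d : ι → WithTop P} {s : T} {i : ι} :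
    Alive (fun i => a (b i)) (fun i => (d i).map a) s i ↔ Alive b d (l s) i := by
  refine and_congr (ha _ _) ?_
  cases h : d i with
  | top => simp [h]
  | coe p => simp only [h, WithTop.map_coe, WithTop.coe_lt_coe, ha.lt_iff_lt]

/-- An interval basis of the restriction of `V` to the times `a p` extends to one of `V`, with the
same intervals, if every `t` has a last time `a (l t) ≤ t` among these, and `V_{a (l t)} ⟶ V_t` is
an isomorphism. -/
def IntervalBasis.extend {V : T ⥤ ModuleCat.{u} R} {a : P → T} {l : T → P}
    (ha : GaloisConnection a l) (hV : ∀ t, IsIso (V.map (homOfLE (ha.l_u_le t))))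
    {ι : Type w} {b : ι → P} {d : ι → WithTop P}
    (B : IntervalBasis (ha.monotone_l.functor ⋙ V) b d) :
    IntervalBasis V (fun i => a (b i)) (fun i => (d i).map a) where
  basis s := ((B.basis (l s)).reindex
    (Equiv.subtypeEquivRight fun _ => (alive_map_iff ha).symm)).map
      (asIso (V.map (homOfLE (ha.l_u_le s)))).toLinearEquiv
  map_basis s t h i := by
    have key : V.map (homOfLE h) (V.map (homOfLE (ha.l_u_le s))
          (B.basis (l s) ⟨i, (alive_map_iff ha).1 i.2⟩)) =
        V.map (homOfLE (ha.l_u_le t)) ((ha.monotone_l.functor ⋙ V).map (homOfLE (ha.monotone_u h))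
          (B.basis (l s) ⟨i, (alive_map_iff ha).1 i.2⟩)) :=
      (map_map_apply _ _ _).trans (map_map_apply _ _ _).symm
    rw [B.map_basis] at key
    have coe_basis (r : T) (j) : ((B.basis (l r)).reindex
        (Equiv.subtypeEquivRight fun _ => (alive_map_iff ha).symm)).map
          (asIso (V.map (homOfLE (ha.l_u_le r)))).toLinearEquiv j =
        V.map (homOfLE (ha.l_u_le r)) (B.basis (l r) ⟨j, (alive_map_iff ha).1 j.2⟩) := by
      refine (Module.Basis.map_apply _ _ _).trans ?_
      rw [Module.Basis.reindex_apply]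
      rfl
    rw [coe_basis s i]
    refine key.trans ?_
    split_ifs with h1 h2 h2
    · exact (coe_basis t ⟨i, h2⟩).symm
    · exact absurd ((alive_map_iff ha).2 h1) h2
    · exact absurd ((alive_map_iff ha).1 h2) h1
    · exact map_zero _

end reindex

/-! ### Persistent homology of a finite filtration -/

/-- The first appearances `a 0 < a 1 < ⋯` of the members of a filtration with finitely many members;
the last of them up to `t` is `a (l t)`, and it is the first appearance of `X t`. -/
theorem exists_galoisConnection_fin {T : Type v} [LinearOrder T] {E : Type*} {X : T → Set E}
    (hX : Monotone X) (hfin : (Set.range X).Finite)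
    (hfirst : ∀ t : T, ∃ a : T, IsLeast {s : T | X s = X t} a) :
    ∃ (n : ℕ) (a : Fin n → T) (l : T → Fin n) (_ : GaloisConnection a l),
      StrictMono a ∧ ∀ t, X (a (l t)) = X t := by
  choose φ hφ using hfirst
  have hφX (t : T) : X (φ t) = X t := (hφ t).1
  have hφle (t : T) : φ t ≤ t := (hφ t).2 rfl
  have hφcongr {s t : T} (h : X s = X t) : φ s = φ t :=
    le_antisymm ((hφ s).2 ((hφX t).trans h.symm)) ((hφ t).2 ((hφX s).trans h))
  have : Finite (Set.range φ) := by
    have := hfin.to_subtype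
    refine Finite.of_injective (fun a : Set.range φ => (⟨X a, a, rfl⟩ : Set.range X)) ?_
    rintro ⟨-, s, rfl⟩ ⟨-, t, rfl⟩ h
    have h' : X (φ s) = X (φ t) := congrArg Subtype.val h
    exact Subtype.ext (hφcongr ((hφX s).symm.trans (h'.trans (hφX t))))
  have := Fintype.ofFinite (Set.range φ)
  let e := Fintype.orderIsoFinOfCardEq (Set.range φ) rfl
  have hgc : GaloisConnection (fun p => (e p : T)) (fun t => e.symm ⟨φ t, t, rfl⟩) := by
    intro p t
    change (e p : T) ≤ t ↔ _
    rw [e.le_symm_apply, ← Subtype.coe_le_coe]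
    obtain ⟨r, hr⟩ := (e p).2
    rw [← hr]
    change φ r ≤ t ↔ φ r ≤ φ t
    refine ⟨fun h => ?_, fun h => h.trans (hφle t)⟩
    by_contra! hlt
    have h1 : X (φ t) = X (φ r) := (hX hlt.le).antisymm ((hX h).trans (hφX t).ge)
    exact hlt.ne (hφcongr ((hφX t).symm.trans (h1.trans (hφX r))))
  exact ⟨_, _, _, hgc, e.strictMono, fun t => by simp [hφX]⟩

/-- The persistent homology over a PID of a filtration with finitely many members and free relative
homology has an interval basis. -/
theorem exists_intervalBasis_persistentHomology {R : Type} [CommRing R] [IsDomain R]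
    [IsPrincipalIdealRing R] {T : Type v} [LinearOrder T] [OrderBot T] {E : Type u}
    [TopologicalSpace E] {X : T → Set E} (hX : Monotone X) (hX_bot : X ⊥ = ∅)
    (hfin : (Set.range X).Finite)
    (hX_first : ∀ t : T, ∃ a : T, IsLeast {s : T | X s = X t} a) (q : ℕ)
    (hrel : ∀ (m n : T) (hmn : m < n), Module.Free R (relativeHomology R q (hX hmn.le))) :
    ∃ (ι : Type u) (b : ι → T) (d : ι → WithTop T), (∀ i, ⊥ < b i ∧ (b i : WithTop T) < d i) ∧
      Nonempty (IntervalBasis (persistentHomology R q X hX) b d) := by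
  obtain ⟨n, a, l, hal, ha, hl⟩ := exists_galoisConnection_fin hX hfin hX_first
  set V := persistentHomology R q X hX
  have hsub : Subsingleton (V.obj ⊥) := by
    have : IsEmpty (TopCat.of (X ⊥)) := by
      rw [hX_bot]; exact inferInstanceAs (IsEmpty (∅ : Set E))
    exact ModuleCat.subsingleton_of_isZero (isZero_homology_of_isEmpty q (TopCat.of (X ⊥)))
  have hcok (s t : T) (h : s ≤ t) :
      Module.Free R (V.obj t ⧸ LinearMap.range (V.map (homOfLE h)).hom) := by
    rcases h.lt_or_eq with hlt | rfl
    · exact free_quotient_range_of_free_relativeHomology q (hX h) (hrel s t hlt)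
    · have : LinearMap.range (V.map (homOfLE h)).hom = ⊤ :=
        LinearMap.range_eq_top.2 fun x => ⟨x, map_refl_apply h x⟩
      rw [this]
      infer_instance
  -- As `V_⊥ = H_q(∅) = 0`, the module `V_t` is the cokernel of `V_⊥ ⟶ V_t`.
  have hfree (t : T) : Module.Free R (V.obj t) := by
    have := hcok ⊥ t bot_le
    refine Module.Free.of_equiv (Submodule.quotEquivOfEqBot
      (LinearMap.range (V.map (homOfLE bot_le)).hom) ?_)
    rw [LinearMap.range_eq_bot]
    ext x
    rw [Subsingleton.elim x 0, map_zero, map_zero]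
  have hiso (t : T) : IsIso (V.map (homOfLE (hal.l_u_le t))) := by
    have := isIso_inclusion (hX (hal.l_u_le t)) (hl t)
    exact inferInstanceAs (IsIso ((homology R q).map (inclusion (hX (hal.l_u_le t)))))
  obtain ⟨ι, b, d, hbd, ⟨B⟩⟩ := exists_intervalBasis (V := hal.monotone_l.functor ⋙ V)
    (fun t => hfree (a t)) (fun s t h => hcok (a s) (a t) (hal.monotone_l h))
  let B' := B.extend hal hiso
  have hlt (i : ι) : (a (b i) : WithTop T) < (d i).map a := ha.withTop_map (hbd i)
  exact ⟨ι, _, _, fun i => ⟨B'.bot_lt hsub i (hlt i), hlt i⟩, ⟨B'⟩⟩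

end

end PersistentHomology

theorem theorem1 {T : Type v} [LinearOrder T] [OrderBot T]
    {E : Type u} [TopologicalSpace E] [T2Space E]
    {C : Set E} [Topology.CWComplex C] [Topology.CWComplex.Finite C]
    (X : T → Topology.CWComplex.Subcomplex C)
    (hX : Monotone fun t => (X t : Set E))
    (hX_bot : (X ⊥ : Set E) = ∅)
    (hX_first : ∀ t : T, ∃ a : T, IsLeast {s : T | (X s : Set E) = X t} a)
    (q : ℕ)
    (hrel : ∀ (m n : T) (hmn : m < n),
      Module.Free ℤ (PersistentHomology.relativeHomology ℤ q (hX hmn.le)))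
    (habs : ∀ p : ℕ, p + 1 = q → ∀ n : T,
      Module.Free ℤ ((PersistentHomology.homology ℤ p).obj (TopCat.of (X n : Set E)))) :
    ∃ (ι : Type u) (b : ι → T) (d : ι → WithTop T),
      (∀ (K : Type) [Field K], PersistentHomology.IsPersistenceDiagram
        (PersistentHomology.persistentHomology K q (fun t => (X t : Set E)) hX) b d) ∧
      ∀ (K : Type) [Field K] (ι' : Type w) (b' : ι' → T) (d' : ι' → WithTop T),
        PersistentHomology.IsPersistenceDiagram
          (PersistentHomology.persistentHomology K q (fun t => (X t : Set E)) hX) b' d' →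
        ∃ σ : ι ≃ ι', ∀ i, b' (σ i) = b i ∧ d' (σ i) = d i := by

  have hfin : (Set.range fun t => (X t : Set E)).Finite := by
    have := PersistentHomology.finite_subcomplex C
    exact (Set.finite_range fun F : Topology.CWComplex.Subcomplex C => (F : Set E)).subset
      (Set.range_subset_iff.2 fun t => ⟨X t, rfl⟩)
  obtain ⟨ι, b, d, hbd, ⟨B⟩⟩ :=
    PersistentHomology.exists_intervalBasis_persistentHomology hX hX_bot hfin hX_first q hrel
  let BK (K : Type) [Field K] := B.extendScalars (Int.castRingHom K) _ hX q habs
  refine ⟨ι, b, d, fun K _ => (BK K).isPersistenceDiagram hbd, fun K _ ι' b' d' h' => ?_⟩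
  obtain ⟨B'⟩ := h'.nonempty_intervalBasis
  exact (BK K).exists_equiv B' (fun i => (hbd i).2) fun i => (h'.1 i).2
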